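/- Let $d,k\ge 1$, $T>0$, $\mathcal X=\{1,\dots,k\}$. For each $i\in\mathcal X$ let $r(i)\ge 0$ and let $\sigma(i)=(\sigma_{l,l'}(i))$ be an invertible real $d\times d$ matrix; put $a_{ll'}(i)=\sum_{j=1}^d\sigma_{l,j}(i)\sigma_{l',j}(i)$. Let $\Lambda=(\lambda_{ij})_{k\times k}$ be the transition rate matrix of a Markov chain on $\mathcal X$, i.e. $\lambda_{ij}\ge 0$ for $i\ne j$ and $\sum_{j}\lambda_{ij}=0$ for every $i$. Let $\mathcal K:(0,\infty)^d\to\mathbb R$ be non-negative and Lipschitz continuous, and suppose that $$-k_3+k_4\cdot s\;\le\;\mathcal K(s)\;\le\;k_1+k_2\cdot s\qquad\text{for all } s\in(0,\infty)^d,$$ for some real numbers $k_1,k_3\ge 0$ and vectors $k_2,k_4\in\mathbb R^d$, where $\cdot$ is the inner product. Let $\phi$ be the classical solution with at most linear growth of the terminal value problem $$\frac{\partial\phi}{\partial t}+r(i)\sum_{l=1}^d s_l\frac{\partial\phi}{\partial s_l}+\frac12\sum_{l=1}^d\sum_{l'=1}^d a_{ll'}(i)s_ls_{l'}\frac{\partial^2\phi}{\partial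 s_l\partial s_{l'}}-r(i)\phi+\sum_{j=1}^k\lambda_{ij}\,\phi(t,s,j)=0\quad\text{on }(0,T)\times(0,\infty)^d\times\mathcal X,$$ $$\phi(T,s,i)=\mathcal K(s)\quad\text{for all }s\in(0,\infty)^d,\ i\in\mathcal X;$$ that is, for every $i$ the function $\phi(\cdot,\cdot,i)$ is of class $C^{1,2}$ on $(0,T)\times(0,\infty)^d$ and continuous on $(0,T]\times(0,\infty)^d$, $\phi$ satisfies the two equations above, and $\sup_{(t,s,i)\in(0,T)\times(0,\infty)^d\times\mathcal X}\frac{|\phi(t,s,i)|}{1+\sum_l|s_l|}<\infty$. Then $$-k_3e^{-(\min_{j}r(j))(T-t)}+k_4\cdot s\;\le\;\phi(t,s,i)\;\le\;k_1e^{-(\min_{j}r(j))(T-t)}+k_2\cdot s$$ for all $(t,s,i)\in(0,T]\times(0,\infty)^d\times\mathcal X$. -/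

import Mathlib

open scoped NNReal

namespace RegimeSwitching

/-- The open positive orthant `(0,∞)^d`. -/
def orthant (d : ℕ) : Set (Fin d → ℝ) := {s | ∀ l, 0 < s l}

/-- `Λ` is the instantaneous transition rate matrix of a (conservative) Markov chain on the finite
state space `Fin k`: off-diagonal entries are nonnegative and every row sums to zero. -/
structure IsRateMatrix {k : ℕ} (Λ : Matrix (Fin k) (Fin k) ℝ) : Prop where
  nonneg : ∀ i j, i ≠ j → 0 ≤ Λ i j
  row_sum : ∀ i, ∑ j, Λ i j = 0

/-- The diffusion matrix `a(i)`, with entries `a_{ll'}(i) = ∑ j, σ_{l,j}(i) σ_{l',j}(i)`. -/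
noncomputable def diffusion {d k : ℕ} (σ : Fin k → Matrix (Fin d) (Fin d) ℝ) (i : Fin k)
    (l l' : Fin d) : ℝ :=
  ∑ j, σ i l j * σ i l' j

/-- The partial derivative `∂f/∂s_l`. -/
noncomputable def partialDeriv {d : ℕ} (l : Fin d) (f : (Fin d → ℝ) → ℝ) (s : Fin d → ℝ) : ℝ :=
  deriv (fun x : ℝ => f (Function.update s l x)) (s l)

/-- The operator
`𝕃φ(t,s,i) = r(i) ∑_l s_l ∂φ/∂s_l + ½ ∑_{l,l'} a_{ll'}(i) s_l s_{l'} ∂²φ/∂s_l∂s_{l'} - r(i) φ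
  + ∑_j λ_{ij} φ(t,s,j)`. -/
noncomputable def operator {d k : ℕ} (r : Fin k → ℝ) (σ : Fin k → Matrix (Fin d) (Fin d) ℝ)
    (Λ : Matrix (Fin k) (Fin k) ℝ) (φ : ℝ → (Fin d → ℝ) → Fin k → ℝ)
    (t : ℝ) (s : Fin d → ℝ) (i : Fin k) : ℝ :=
  r i * ∑ l, s l * partialDeriv l (fun x => φ t x i) s
    + (1 / 2) * ∑ l, ∑ l', diffusion σ i l l' * s l * s l' *
        partialDeriv l (partialDeriv l' (fun x => φ t x i)) s
    - r i * φ t s i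
    + ∑ j, Λ i j * φ t s j

/-- `u` is of class `C^{1,2}` on `(0,T) × (0,∞)^d`: it is differentiable in `t`, twice continuously
differentiable in `s`, and the derivatives `∂u/∂t`, `∂u/∂s_l`, `∂²u/∂s_l∂s_{l'}` are jointly
continuous. -/
structure IsC12 {d : ℕ} (T : ℝ) (u : ℝ → (Fin d → ℝ) → ℝ) : Prop where
  diff_t : ∀ t ∈ Set.Ioo 0 T, ∀ s ∈ orthant d, DifferentiableAt ℝ (fun τ => u τ s) t
  contDiff_s : ∀ t ∈ Set.Ioo 0 T, ContDiffOn ℝ 2 (u t) (orthant d)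
  cont_t : ContinuousOn (fun p : ℝ × (Fin d → ℝ) => deriv (fun τ => u τ p.2) p.1)
    (Set.Ioo 0 T ×ˢ orthant d)
  cont_s : ∀ l, ContinuousOn (fun p : ℝ × (Fin d → ℝ) => partialDeriv l (u p.1) p.2)
    (Set.Ioo 0 T ×ˢ orthant d)
  cont_ss : ∀ l l', ContinuousOn
    (fun p : ℝ × (Fin d → ℝ) => partialDeriv l (partialDeriv l' (u p.1)) p.2)
    (Set.Ioo 0 T ×ˢ orthant d)

/-- `φ` is a classical solution of the terminal value problem `∂φ/∂t + 𝕃φ = 0` on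
`(0,T) × (0,∞)^d × {1,…,k}`, `φ(T,s,i) = 𝒦(s)`: every component is of class `C^{1,2}` in the
interior and continuous up to the terminal time. -/
structure IsClassicalSolution {d k : ℕ} (T : ℝ) (r : Fin k → ℝ)
    (σ : Fin k → Matrix (Fin d) (Fin d) ℝ) (Λ : Matrix (Fin k) (Fin k) ℝ)
    (K : (Fin d → ℝ) → ℝ) (φ : ℝ → (Fin d → ℝ) → Fin k → ℝ) : Prop where
  regular : ∀ i, IsC12 T (fun t s => φ t s i)
  cont : ∀ i, ContinuousOn (fun p : ℝ × (Fin d → ℝ) => φ p.1 p.2 i) (Set.Ioc 0 T ×ˢ orthant d)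
  pde : ∀ t ∈ Set.Ioo 0 T, ∀ s ∈ orthant d, ∀ i,
    deriv (fun τ => φ τ s i) t + operator r σ Λ φ t s i = 0
  terminal : ∀ s ∈ orthant d, ∀ i, φ T s i = K s

/-- Membership in the space `V` of (componentwise) continuous functions on
`(0,T) × (0,∞)^d × {1,…,k}` with `sup |φ(t,s,i)| / (1 + ‖s‖₁) < ∞`. -/
structure MemV {d k : ℕ} (T : ℝ) (φ : ℝ → (Fin d → ℝ) → Fin k → ℝ) : Prop where
  cont : ∀ i, ContinuousOn (fun p : ℝ × (Fin d → ℝ) => φ p.1 p.2 i) (Set.Ioo 0 T ×ˢ orthant d)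
  bounded : ∃ C : ℝ, ∀ t ∈ Set.Ioo 0 T, ∀ s ∈ orthant d, ∀ i,
    |φ t s i / (1 + ∑ l, |s l|)| ≤ C

end RegimeSwitching

namespace RegimeSwitching

open Filter Topology Set

variable {d k : ℕ}

/-! Both bounds are comparisons with explicit barriers. With `m = min r` and `b ≥ 0`, the function
`b e^{-m(T-t)} + q · s` is a supersolution: discounted `s_l` solves the equation exactly, and the
exponential leaves `(m - r i) b e^{-m(T-t)} ≤ 0`. So `φ + k₃ e^{-m(T-t)} - k₄ · s` and `-φ + k₁
e^{-m(T-t)} + k₂ · s` are supersolutions, nonnegative at `T` and of linear growth.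

It remains to prove a minimum principle (`nonneg_of_supersolution`) on an unbounded domain with no
lateral boundary data. Adding `ε e^{A(T-t)} lyapunov s` makes the inequality strict and confines
negative values to a compact box (`exists_operator_lyapunov_lt`, `exists_box_of_lyapunov_lt`). A
negative minimum over time, space and regimes then contradicts strictness
(`nonneg_of_strict_supersolution`). Finally `ε → 0`. -/

theorem isOpen_orthant : IsOpen (orthant d) := by
  have : orthant d = ⋂ l, {s : Fin d → ℝ | 0 < s l} := by
    ext s; simp [orthant]
  rw [this]
  exact isOpen_iInter_of_finite fun l => isOpen_lt continuous_const (continuous_apply l)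

/-! ### Partial derivatives and derivative tests at a minimum -/

theorem partialDeriv_eq_fderiv {f : (Fin d → ℝ) → ℝ} {s : Fin d → ℝ} (l : Fin d)
    (hf : DifferentiableAt ℝ f s) :
    partialDeriv l f s = fderiv ℝ f s (Pi.single l 1) := by
  have h1 : HasDerivAt (Function.update s l) (Pi.single l (1 : ℝ)) (s l) :=
    hasDerivAt_update s l (s l)
  have h2 : HasFDerivAt f (fderiv ℝ f s) (Function.update s l (s l)) := by
    rw [Function.update_eq_self]; exact hf.hasFDerivAt
  exact (h2.comp_hasDerivAt (s l) h1).deriv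

theorem partialDeriv_congr {f g : (Fin d → ℝ) → ℝ} {s : Fin d → ℝ} (l : Fin d)
    (h : f =ᶠ[𝓝 s] g) : partialDeriv l f s = partialDeriv l g s := by
  have h1 : Tendsto (Function.update s l) (𝓝 (s l)) (𝓝 s) := by
    have := (hasDerivAt_update s l (s l)).continuousAt.tendsto
    rwa [Function.update_eq_self] at this
  exact (show (fun x => f (Function.update s l x)) =ᶠ[𝓝 (s l)] fun x => g (Function.update s l x) from
    h1.eventually h).deriv_eq

theorem partialDeriv_partialDeriv_eq_fderiv {f : (Fin d → ℝ) → ℝ} {s : Fin d → ℝ}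
    (hf : ContDiffAt ℝ 2 f s) (l l' : Fin d) :
    partialDeriv l (partialDeriv l' f) s =
      fderiv ℝ (fderiv ℝ f) s (Pi.single l 1) (Pi.single l' 1) := by
  have h1 : partialDeriv l' f =ᶠ[𝓝 s] fun x => fderiv ℝ f x (Pi.single l' 1) := by
    filter_upwards [hf.eventually (by simp)] with x hx
    exact partialDeriv_eq_fderiv l' (hx.differentiableAt (by simp))
  have h2 : DifferentiableAt ℝ (fderiv ℝ f) s :=
    (hf.fderiv_right (m := 1) (by norm_num)).differentiableAt (by simp)
  rw [partialDeriv_congr l h1,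
    partialDeriv_eq_fderiv l (h2.clm_apply (differentiableAt_const _))]
  rw [fderiv_clm_apply h2 (differentiableAt_const _)]
  simp

/-- Were it negative, `x` would also be a local maximum, so `h` would be locally constant and its
second derivative zero. -/
theorem deriv_deriv_nonneg_of_isLocalMin {h : ℝ → ℝ} {x : ℝ} (hmin : IsLocalMin h x)
    (hc : ContinuousAt h x) : 0 ≤ deriv (deriv h) x := by
  by_contra! hneg
  have hmax := isLocalMax_of_deriv_deriv_neg hneg hmin.deriv_eq_zero hc
  have hconst : h =ᶠ[𝓝 x] fun _ => h x := by
    filter_upwards [hmin, hmax] with y h1 h2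
    exact le_antisymm h2 h1
  have := hconst.deriv.deriv_eq
  simp at this
  linarith

theorem fderiv_fderiv_nonneg_of_isLocalMin {f : (Fin d → ℝ) → ℝ} {s : Fin d → ℝ}
    (hmin : IsLocalMin f s) (hf : ContDiffAt ℝ 2 f s) (y : Fin d → ℝ) :
    0 ≤ fderiv ℝ (fderiv ℝ f) s y y := by
  have hline : ∀ x : ℝ, HasDerivAt (fun x : ℝ => s + x • y) y x := fun x => by
    simpa using ((hasDerivAt_id x).smul_const y).const_add s
  have h0 : s + (0 : ℝ) • y = s := by simp
  have hcont : Tendsto (fun x : ℝ => s + x • y) (𝓝 0) (𝓝 s) := by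
    have := (hline 0).continuousAt.tendsto
    rwa [h0] at this
  have hd1 : deriv (fun x : ℝ => f (s + x • y)) =ᶠ[𝓝 0] fun x => fderiv ℝ f (s + x • y) y := by
    filter_upwards [hcont.eventually (hf.eventually (by simp))] with x hx
    have h1 : HasFDerivAt f (fderiv ℝ f (s + x • y)) (s + x • y) :=
      (hx.differentiableAt (by simp)).hasFDerivAt
    exact (h1.comp_hasDerivAt x (hline x)).deriv
  have h2 : HasFDerivAt (fderiv ℝ f) (fderiv ℝ (fderiv ℝ f) s) (s + (0 : ℝ) • y) := by
    rw [h0]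
    exact ((hf.fderiv_right (m := 1) (by norm_num)).differentiableAt (by simp)).hasFDerivAt
  have hd2 : HasDerivAt (fun x : ℝ => fderiv ℝ f (s + x • y) y)
      (fderiv ℝ (fderiv ℝ f) s y y) 0 := by
    have h3 : HasDerivAt (fun x : ℝ => fderiv ℝ f (s + x • y)) (fderiv ℝ (fderiv ℝ f) s y) 0 :=
      h2.comp_hasDerivAt 0 (hline 0)
    exact ((ContinuousLinearMap.apply ℝ ℝ y).hasFDerivAt (x := fderiv ℝ f (s + (0 : ℝ) • y))
      ).comp_hasDerivAt 0 h3
  have hmin' : IsLocalMin (fun x : ℝ => f (s + x • y)) 0 := by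
    have := hcont.eventually hmin
    filter_upwards [this] with x hx
    simpa using hx
  have hc : ContinuousAt (fun x : ℝ => f (s + x • y)) 0 := by
    have h3 : ContinuousAt f (s + (0 : ℝ) • y) := by rw [h0]; exact hf.continuousAt
    exact h3.comp (f := fun x : ℝ => s + x • y) (hline 0).continuousAt
  have := deriv_deriv_nonneg_of_isLocalMin hmin' hc
  rwa [hd1.deriv_eq, hd2.deriv] at this

theorem partialDeriv_eq_zero_of_isLocalMin {f : (Fin d → ℝ) → ℝ} {s : Fin d → ℝ}
    (hmin : IsLocalMin f s) (hf : DifferentiableAt ℝ f s) (l : Fin d) :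
    partialDeriv l f s = 0 := by
  rw [partialDeriv_eq_fderiv l hf, hmin.fderiv_eq_zero]; rfl

/-- Since `a = σ σᵀ`, the sum is the Hessian evaluated on the diagonal at each column of `σ i` with
entries scaled by `s l`, summed over columns. -/
theorem sum_diffusion_nonneg_of_isLocalMin {f : (Fin d → ℝ) → ℝ} {s : Fin d → ℝ}
    (hmin : IsLocalMin f s) (hf : ContDiffAt ℝ 2 f s)
    (σ : Fin k → Matrix (Fin d) (Fin d) ℝ) (i : Fin k) :
    0 ≤ ∑ l, ∑ l', diffusion σ i l l' * s l * s l' * partialDeriv l (partialDeriv l' f) s := by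
  set B := fderiv ℝ (fderiv ℝ f) s
  have key : ∑ l, ∑ l', diffusion σ i l l' * s l * s l' * partialDeriv l (partialDeriv l' f) s =
      ∑ j, B (∑ l, (σ i l j * s l) • Pi.single l (1 : ℝ))
        (∑ l, (σ i l j * s l) • Pi.single l (1 : ℝ)) := by
    have hB : ∀ c : Fin d → ℝ, B (∑ l, c l • Pi.single l (1 : ℝ)) (∑ l, c l • Pi.single l (1 : ℝ)) =
        ∑ l, ∑ l', c l * c l' * B (Pi.single l 1) (Pi.single l' 1) := fun c => by
      rw [map_sum B, sum_apply]
      refine Finset.sum_congr rfl fun l _ => ?_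
      rw [map_sum]
      refine Finset.sum_congr rfl fun l' _ => ?_
      rw [map_smul, map_smul, smul_apply, smul_eq_mul, smul_eq_mul]
      ring
    simp only [hB]
    symm
    rw [Finset.sum_comm]
    refine Finset.sum_congr rfl fun l _ => ?_
    rw [Finset.sum_comm]
    refine Finset.sum_congr rfl fun l' _ => ?_
    rw [partialDeriv_partialDeriv_eq_fderiv hf, diffusion, mul_assoc, mul_assoc, Finset.sum_mul]
    exact Finset.sum_congr rfl fun j _ => by simp only [B]; ring
  rw [key]
  exact Finset.sum_nonneg fun j _ => fderiv_fderiv_nonneg_of_isLocalMin hmin hf _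

theorem partialDeriv_add {f g : (Fin d → ℝ) → ℝ} {s : Fin d → ℝ} (l : Fin d)
    (hf : DifferentiableAt ℝ f s) (hg : DifferentiableAt ℝ g s) :
    partialDeriv l (fun x => f x + g x) s = partialDeriv l f s + partialDeriv l g s := by
  rw [partialDeriv_eq_fderiv l hf, partialDeriv_eq_fderiv l hg,
    partialDeriv_eq_fderiv l (hf.fun_add hg), fderiv_fun_add hf hg]
  rfl

theorem partialDeriv_partialDeriv_add {f g : (Fin d → ℝ) → ℝ} {s : Fin d → ℝ} (l l' : Fin d)
    (hf : ContDiffAt ℝ 2 f s) (hg : ContDiffAt ℝ 2 g s) :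
    partialDeriv l (partialDeriv l' (fun x => f x + g x)) s =
      partialDeriv l (partialDeriv l' f) s + partialDeriv l (partialDeriv l' g) s := by
  have h : fderiv ℝ (fun x => f x + g x) =ᶠ[𝓝 s] fun x => fderiv ℝ f x + fderiv ℝ g x := by
    filter_upwards [hf.eventually (by simp), hg.eventually (by simp)] with x h1 h2
    exact fderiv_fun_add (h1.differentiableAt (by simp)) (h2.differentiableAt (by simp))
  rw [partialDeriv_partialDeriv_eq_fderiv hf, partialDeriv_partialDeriv_eq_fderiv hg,
    partialDeriv_partialDeriv_eq_fderiv (hf.add hg), h.fderiv_eq,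
    fderiv_fun_add ((hf.fderiv_right (m := 1) (by norm_num)).differentiableAt (by simp))
      ((hg.fderiv_right (m := 1) (by norm_num)).differentiableAt (by simp))]
  rfl

theorem partialDeriv_const_mul (c : ℝ) (f : (Fin d → ℝ) → ℝ) (l : Fin d) :
    partialDeriv l (fun x => c * f x) = fun s => c * partialDeriv l f s := by
  funext s
  simp only [partialDeriv, deriv_const_mul_field]

/-! ### Linearity of the operator and its sign at a minimum -/

section Operator

variable (r : Fin k → ℝ) (σ : Fin k → Matrix (Fin d) (Fin d) ℝ) (Λ : Matrix (Fin k) (Fin k) ℝ)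

theorem operator_add {u v : ℝ → (Fin d → ℝ) → Fin k → ℝ} {t : ℝ} {s : Fin d → ℝ} {i : Fin k}
    (hu : ContDiffAt ℝ 2 (fun x => u t x i) s) (hv : ContDiffAt ℝ 2 (fun x => v t x i) s) :
    operator r σ Λ (fun t x j => u t x j + v t x j) t s i =
      operator r σ Λ u t s i + operator r σ Λ v t s i := by
  simp only [operator,
    partialDeriv_add _ (hu.differentiableAt (by simp)) (hv.differentiableAt (by simp)),
    partialDeriv_partialDeriv_add _ _ hu hv, mul_add, Finset.sum_add_distrib]
  ring

theorem operator_const_mul (c : ℝ → ℝ) (u : ℝ → (Fin d → ℝ) → Fin k → ℝ) (t : ℝ) (s : Fin d → ℝ)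
    (i : Fin k) :
    operator r σ Λ (fun t x j => c t * u t x j) t s i = c t * operator r σ Λ u t s i := by
  simp only [operator, partialDeriv_const_mul]
  have h1 : ∀ f : Fin d → ℝ, ∑ l, s l * (c t * f l) = c t * ∑ l, s l * f l := fun f => by
    rw [Finset.mul_sum]; exact Finset.sum_congr rfl fun l _ => by ring
  have h2 : ∀ f g : Fin d → Fin d → ℝ,
      ∑ l, ∑ l', f l l' * (c t * g l l') = c t * ∑ l, ∑ l', f l l' * g l l' := fun f g => by
    simp only [Finset.mul_sum]
    exact Finset.sum_congr rfl fun l _ => Finset.sum_congr rfl fun l' _ => by ring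
  have h3 : ∑ j, Λ i j * (c t * u t s j) = c t * ∑ j, Λ i j * u t s j := by
    rw [Finset.mul_sum]; exact Finset.sum_congr rfl fun l _ => by ring
  rw [h1, h2, h3]
  ring

/-- Minimality over regimes controls the coupling: row sums vanish and off-diagonal rates are
nonnegative, so replacing each `v t s j` by the smaller `v t s i` gives the lower bound zero. -/
theorem operator_nonneg_of_min {Λ} (hr : ∀ i, 0 ≤ r i) (hΛ : IsRateMatrix Λ)
    {v : ℝ → (Fin d → ℝ) → Fin k → ℝ} {t : ℝ} {s : Fin d → ℝ} {i : Fin k}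
    (hv : ContDiffAt ℝ 2 (fun x => v t x i) s) (hmin : IsLocalMin (fun x => v t x i) s)
    (hneg : v t s i ≤ 0) (hi : ∀ j, v t s i ≤ v t s j) : 0 ≤ operator r σ Λ v t s i := by
  have h1 : ∑ l, s l * partialDeriv l (fun x => v t x i) s = 0 :=
    Finset.sum_eq_zero fun l _ => by
      rw [partialDeriv_eq_zero_of_isLocalMin hmin (hv.differentiableAt (by simp)), mul_zero]
  have h2 := sum_diffusion_nonneg_of_isLocalMin hmin hv σ i
  have h3 : 0 ≤ ∑ j, Λ i j * v t s j := by
    calc 0 = ∑ j, Λ i j * v t s i := by rw [← Finset.sum_mul, hΛ.row_sum, zero_mul]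
      _ ≤ _ := Finset.sum_le_sum fun j _ => by
        rcases eq_or_ne i j with rfl | hij
        · exact le_rfl
        · exact mul_le_mul_of_nonneg_left (hi j) (hΛ.nonneg i j hij)
  have h4 := mul_nonneg (hr i) (neg_nonneg.2 hneg)
  simp only [operator, h1]
  linarith

end Operator

/-! ### Separable test functions and the Lyapunov function -/

theorem partialDeriv_comp_apply (h : ℝ → ℝ) (l m : Fin d) (s : Fin d → ℝ) :
    partialDeriv l (fun x => h (x m)) s = if l = m then deriv h (s m) else 0 := by
  unfold partialDeriv
  split_ifs with hlm
  · subst hlm; simp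
  · simp [Function.update_of_ne (Ne.symm hlm)]

theorem partialDeriv_const_add_sum (c : ℝ) {h : Fin d → ℝ → ℝ} (l : Fin d) {s : Fin d → ℝ}
    (hh : ∀ m, DifferentiableAt ℝ (h m) (s m)) :
    partialDeriv l (fun x => c + ∑ m, h m (x m)) s = deriv (h l) (s l) := by
  have hd : ∀ m, DifferentiableAt ℝ (fun x : ℝ => h m (Function.update s l x m)) (s l) := by
    intro m
    rcases eq_or_ne m l with rfl | hm
    · simpa using hh m
    · simp [Function.update_of_ne hm]
  have := fun m => partialDeriv_comp_apply (h m) l m s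
  unfold partialDeriv at this ⊢
  rw [deriv_const_add, deriv_fun_sum fun m _ => hd m]
  simp [this]

theorem partialDeriv_partialDeriv_const_add_sum (c : ℝ) {h : Fin d → ℝ → ℝ} (l l' : Fin d)
    {s : Fin d → ℝ} (hs : s ∈ orthant d) (hh : ∀ m, ∀ x > 0, DifferentiableAt ℝ (h m) x) :
    partialDeriv l (partialDeriv l' (fun x => c + ∑ m, h m (x m))) s =
      if l = l' then deriv (deriv (h l')) (s l') else 0 := by
  rw [← partialDeriv_comp_apply]
  apply partialDeriv_congr
  filter_upwards [isOpen_orthant.mem_nhds hs] with x hx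
  exact partialDeriv_const_add_sum c l' fun m => hh m _ (hx m)

/-- Separability kills the mixed derivatives and independence of the regime kills the coupling.
Serves both the Lyapunov function and the affine barrier. -/
theorem operator_const_add_sum (r : Fin k → ℝ) (σ : Fin k → Matrix (Fin d) (Fin d) ℝ)
    {Λ : Matrix (Fin k) (Fin k) ℝ} (hΛ : IsRateMatrix Λ) (c : ℝ → ℝ) {h : Fin d → ℝ → ℝ} (t : ℝ)
    {s : Fin d → ℝ} (hs : s ∈ orthant d) (hh : ∀ m, ∀ x > 0, DifferentiableAt ℝ (h m) x)
    (i : Fin k) :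
    operator r σ Λ (fun t x _ => c t + ∑ m, h m (x m)) t s i =
      r i * ∑ l, s l * deriv (h l) (s l)
        + (1 / 2) * ∑ l, diffusion σ i l l * s l * s l * deriv (deriv (h l)) (s l)
        - r i * (c t + ∑ m, h m (s m)) := by
  simp only [operator, partialDeriv_partialDeriv_const_add_sum _ _ _ hs hh,
    partialDeriv_const_add_sum _ _ fun m => hh m _ (hs m), ← Finset.sum_mul, hΛ.row_sum]
  simp

/-- The Lyapunov function `1 + ∑ l, (s_l² + s_l⁻¹)`, which blows up at the boundary of the orthant
and superlinearly at infinity. -/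
noncomputable def lyapunov (s : Fin d → ℝ) : ℝ := 1 + ∑ m, (s m ^ 2 + (s m)⁻¹)

theorem one_le_lyapunov {s : Fin d → ℝ} (hs : s ∈ orthant d) : 1 ≤ lyapunov s :=
  le_add_of_nonneg_right (Finset.sum_nonneg fun m _ => by have := hs m; positivity)

theorem contDiffOn_lyapunov : ContDiffOn ℝ 2 (lyapunov (d := d)) (orthant d) := by
  unfold lyapunov
  refine contDiffOn_const.add (ContDiffOn.sum fun m _ => ?_)
  have h : ContDiffOn ℝ 2 (fun x : Fin d → ℝ => x m) (orthant d) :=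
    (contDiff_apply ℝ ℝ m).contDiffOn
  exact (h.pow 2).add (h.inv fun x hx => (hx m).ne')

theorem hasDerivAt_sq_add_inv {x : ℝ} (hx : 0 < x) :
    HasDerivAt (fun y : ℝ => y ^ 2 + y⁻¹) (2 * x - (x ^ 2)⁻¹) x := by
  refine ((hasDerivAt_pow 2 x).fun_add (hasDerivAt_inv hx.ne')).congr_deriv ?_
  norm_num [sub_eq_add_neg]

theorem deriv_deriv_sq_add_inv {x : ℝ} (hx : 0 < x) :
    deriv (deriv fun y : ℝ => y ^ 2 + y⁻¹) x = 2 + 2 * (x ^ 3)⁻¹ := by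
  have h : deriv (fun y : ℝ => y ^ 2 + y⁻¹) =ᶠ[𝓝 x] fun y => 2 * y - (y ^ 2)⁻¹ := by
    filter_upwards [Ioi_mem_nhds hx] with y hy
    exact (hasDerivAt_sq_add_inv hy).deriv
  rw [h.deriv_eq]
  have h2 := ((hasDerivAt_id x).const_mul 2).sub
    ((hasDerivAt_pow 2 x).fun_inv (pow_ne_zero 2 hx.ne'))
  refine (h2.congr_deriv ?_).deriv
  norm_num
  field_simp
  ring

theorem exists_operator_lyapunov_lt {r : Fin k → ℝ} (hr : ∀ i, 0 ≤ r i)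
    (σ : Fin k → Matrix (Fin d) (Fin d) ℝ) {Λ : Matrix (Fin k) (Fin k) ℝ} (hΛ : IsRateMatrix Λ) :
    ∃ A : ℝ, 0 ≤ A ∧ ∀ t, ∀ s ∈ orthant d, ∀ i,
      operator r σ Λ (fun _ x _ => lyapunov x) t s i < A * lyapunov s := by
  have ha : ∀ i l, 0 ≤ diffusion σ i l l := fun i l =>
    Finset.sum_nonneg fun j _ => mul_self_nonneg _
  set D : Fin k → ℝ := fun i => 2 * r i + ∑ l, diffusion σ i l l
  have hD : ∀ i, 0 ≤ D i := fun i =>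
    add_nonneg (by linarith [hr i]) (Finset.sum_nonneg fun l _ => ha i l)
  -- `D i` bounds drift plus diffusion in regime `i`; summing makes it uniform in `i`, and the extra
  -- `1` gives strictness because `lyapunov s ≥ 1`.
  refine ⟨∑ i, D i + 1, by linarith [Finset.sum_nonneg fun i (_ : i ∈ Finset.univ) => hD i],
    fun t s hs i => ?_⟩
  have hL := one_le_lyapunov hs
  have hDi : D i ≤ ∑ i, D i := Finset.single_le_sum (fun j _ => hD j) (Finset.mem_univ i)
  set q : Fin d → ℝ := fun l => s l ^ 2 + (s l)⁻¹
  have hq : ∀ l, 0 ≤ q l := fun l => by have := hs l; positivity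
  have hq1 : ∀ l, q l ≤ lyapunov s := fun l => by
    have := Finset.single_le_sum (fun j _ => hq j) (Finset.mem_univ l)
    simp only [lyapunov]
    linarith
  have hop := operator_const_add_sum r σ hΛ (fun _ => 1) (h := fun _ y => y ^ 2 + y⁻¹) t hs
    (fun _ x hx => (hasDerivAt_sq_add_inv hx).differentiableAt) i
  change operator r σ Λ (fun _ x _ => lyapunov x) t s i = _ at hop
  have h1 : ∑ l, s l * deriv (fun y : ℝ => y ^ 2 + y⁻¹) (s l) ≤ 2 * lyapunov s := by
    calc _ ≤ ∑ l, 2 * q l := Finset.sum_le_sum fun l _ => by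
          have h0 := hs l
          rw [(hasDerivAt_sq_add_inv h0).deriv]
          have : s l * (2 * s l - (s l ^ 2)⁻¹) = 2 * s l ^ 2 - (s l)⁻¹ := by field_simp
          rw [this]
          have := inv_pos.2 h0
          simp only [q]
          linarith
      _ ≤ _ := by rw [← Finset.mul_sum]; simp only [lyapunov, q]; linarith
  have h2 : ∑ l, diffusion σ i l l * s l * s l * deriv (deriv fun y : ℝ => y ^ 2 + y⁻¹) (s l) ≤
      (∑ l, diffusion σ i l l) * (2 * lyapunov s) := by
    rw [Finset.sum_mul]
    refine Finset.sum_le_sum fun l _ => ?_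
    have h0 := hs l
    rw [deriv_deriv_sq_add_inv h0]
    have : diffusion σ i l l * s l * s l * (2 + 2 * (s l ^ 3)⁻¹) =
        diffusion σ i l l * (2 * q l) := by
      simp only [q]; field_simp
    rw [this]
    exact mul_le_mul_of_nonneg_left (by linarith [hq1 l]) (ha i l)
  have h3 := mul_le_mul_of_nonneg_left h1 (hr i)
  have h4 : 0 ≤ r i * lyapunov s := mul_nonneg (hr i) (by linarith)
  have h5 := mul_le_mul_of_nonneg_right hDi (by linarith : 0 ≤ lyapunov s)
  rw [hop]
  change _ - r i * lyapunov s < _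
  simp only [D] at h5 ⊢
  linarith

theorem exists_box_of_lyapunov_lt (d : ℕ) {ε C : ℝ} (hε : 0 < ε) (hC : 0 ≤ C) :
    ∃ B : ℝ, 0 < B ∧ ∀ s ∈ orthant d, ε * lyapunov s < C * (1 + ∑ l, s l) →
      ∀ l, B⁻¹ < s l ∧ s l < B := by
  -- Completing the square absorbs each `C * s m` into half of `ε * s m ^ 2`, at cost `C ^ 2 / (2 *
  -- ε)` per coordinate.
  set M := C + d * (C ^ 2 / (2 * ε))
  have hM : 0 ≤ M := by positivity
  have hN : 0 ≤ 2 * M / ε := by positivity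
  -- The `+ 1` allows `s l ≤ s l ^ 2 + 1` to give the upper bound without a square root.
  refine ⟨2 * M / ε + 1, by linarith, fun s hs h l => ?_⟩
  have h0 := hs l
  have hterm : ∀ m, (ε / 2) * (s m ^ 2 + (s m)⁻¹) ≤
      ε * (s m ^ 2 + (s m)⁻¹) - C * s m + C ^ 2 / (2 * ε) := fun m => by
    have h1 := inv_pos.2 (hs m)
    have h2 : 0 ≤ (ε * s m - C) ^ 2 / (2 * ε) := by positivity
    have h3 : (ε * s m - C) ^ 2 / (2 * ε) = (ε / 2) * s m ^ 2 - C * s m + C ^ 2 / (2 * ε) := by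
      field_simp
      ring
    have := mul_pos hε h1
    linarith
  have hsum : ∑ m, (ε / 2) * (s m ^ 2 + (s m)⁻¹) < M := by
    calc _ ≤ _ := Finset.sum_le_sum fun m _ => hterm m
      _ = ε * lyapunov s - ε - C * ∑ l, s l + d * (C ^ 2 / (2 * ε)) := by
        simp only [Finset.sum_add_distrib, Finset.sum_sub_distrib, ← Finset.mul_sum, lyapunov]
        simp
        ring
      _ < M := by simp only [M]; linarith
  have hl : s l ^ 2 + (s l)⁻¹ < 2 * M / ε := by
    have := (Finset.single_le_sum (f := fun m => (ε / 2) * (s m ^ 2 + (s m)⁻¹))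
      (fun m _ => by have := hs m; positivity) (Finset.mem_univ l)).trans_lt hsum
    rw [lt_div_iff₀ hε]
    linarith
  have hi := inv_pos.2 h0
  constructor
  · exact inv_lt_of_inv_lt₀ h0 (by nlinarith)
  · nlinarith

/-! ### Minimum principle and comparison -/

theorem deriv_nonneg_of_forall_ge {f : ℝ → ℝ} {a b : ℝ} (hab : a < b)
    (hf : DifferentiableAt ℝ f a) (h : ∀ x ∈ Ioo a b, f a ≤ f x) : 0 ≤ deriv f a := by
  have h1 := hf.hasDerivAt.hasDerivWithinAt (s := Ioi a)
  rw [hasDerivWithinAt_iff_tendsto_slope' self_notMem_Ioi] at h1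
  refine ge_of_tendsto h1 ?_
  filter_upwards [Ioo_mem_nhdsGT hab] with x hx
  rw [slope_def_field]
  exact div_nonneg (sub_nonneg.2 (h x hx)) (sub_nonneg.2 hx.1.le)

theorem nonneg_of_strict_supersolution {T : ℝ} {r : Fin k → ℝ} (hr : ∀ i, 0 ≤ r i)
    (σ : Fin k → Matrix (Fin d) (Fin d) ℝ) {Λ : Matrix (Fin k) (Fin k) ℝ} (hΛ : IsRateMatrix Λ)
    {v : ℝ → (Fin d → ℝ) → Fin k → ℝ}
    (hdt : ∀ t ∈ Ioo 0 T, ∀ s ∈ orthant d, ∀ i, DifferentiableAt ℝ (fun τ => v τ s i) t)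
    (hds : ∀ t ∈ Ioo 0 T, ∀ s ∈ orthant d, ∀ i, ContDiffAt ℝ 2 (fun x => v t x i) s)
    (hcont : ∀ i, ContinuousOn (fun p : ℝ × (Fin d → ℝ) => v p.1 p.2 i) (Ioc 0 T ×ˢ orthant d))
    (hsuper : ∀ t ∈ Ioo 0 T, ∀ s ∈ orthant d, ∀ i,
      deriv (fun τ => v τ s i) t + operator r σ Λ v t s i < 0)
    (hT : ∀ s ∈ orthant d, ∀ i, 0 ≤ v T s i) {B : ℝ} (hB : 0 < B)
    (hbox : ∀ t ∈ Ioo 0 T, ∀ s ∈ orthant d, ∀ i, v t s i < 0 → ∀ l, B⁻¹ < s l ∧ s l < B) :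
    ∀ t ∈ Ioc 0 T, ∀ s ∈ orthant d, ∀ i, 0 ≤ v t s i := by
  intro t₁ ht₁ s₁ hs₁ i₁
  by_contra! hneg
  have ht₁T : t₁ < T := by
    refine lt_of_le_of_ne ht₁.2 fun h => ?_
    subst h
    exact (hT s₁ hs₁ i₁).not_gt hneg
  -- Time starts at `t₁`, as nothing is assumed at time `0`. The minimum may lie on this first
  -- slice, where only the right-hand difference quotient is available.
  set Q : Set (ℝ × (Fin d → ℝ)) := Icc t₁ T ×ˢ Set.pi univ fun _ => Icc B⁻¹ B
  have hQc : IsCompact Q := isCompact_Icc.prod (isCompact_univ_pi fun _ => isCompact_Icc)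
  have hQs : Q ⊆ Ioc 0 T ×ˢ orthant d := fun p hp =>
    ⟨⟨ht₁.1.trans_le hp.1.1, hp.1.2⟩, fun l => (inv_pos.2 hB).trans_le (hp.2 l trivial).1⟩
  have hQ₁ : (t₁, s₁) ∈ Q := by
    have := hbox t₁ ⟨ht₁.1, ht₁T⟩ s₁ hs₁ i₁ hneg
    exact ⟨⟨le_rfl, ht₁.2⟩, fun l _ => ⟨(this l).1.le, (this l).2.le⟩⟩
  have hex : ∀ i, ∃ p ∈ Q, ∀ q ∈ Q, v p.1 p.2 i ≤ v q.1 q.2 i := fun i =>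
    hQc.exists_isMinOn ⟨_, hQ₁⟩ ((hcont i).mono hQs)
  choose p hpQ hpmin using hex
  obtain ⟨i, -, hi⟩ := Finset.exists_min_image Finset.univ (fun i => v (p i).1 (p i).2 i)
    ⟨i₁, Finset.mem_univ _⟩
  obtain ⟨⟨t, s⟩, hts⟩ : ∃ z, z = p i := ⟨_, rfl⟩
  have hQ := hpQ i
  have hmin : ∀ j, ∀ q ∈ Q, v t s i ≤ v q.1 q.2 j := fun j q hq => by
    have := (hi j (Finset.mem_univ j)).trans (hpmin j q hq)
    rwa [← hts] at this
  rw [← hts] at hQ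
  have hlt : v t s i < 0 := (hmin i₁ _ hQ₁).trans_lt hneg
  have hs : s ∈ orthant d := (hQs hQ).2
  have htT : t < T := by
    refine lt_of_le_of_ne hQ.1.2 fun h => ?_
    change t = T at h
    subst h
    exact (hT s hs i).not_gt hlt
  have ht : t ∈ Ioo 0 T := ⟨(hQs hQ).1.1, htT⟩
  -- Negativity forces the minimizer strictly inside the box, so it is a local minimum in space.
  have hsbox := hbox t ht s hs i hlt
  have hloc : IsLocalMin (fun x => v t x i) s := by
    have hopen : Set.pi univ (fun _ : Fin d => Ioo B⁻¹ B) ∈ 𝓝 s :=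
      (isOpen_set_pi finite_univ fun _ _ => isOpen_Ioo).mem_nhds fun l _ => hsbox l
    filter_upwards [hopen] with x hx
    exact hmin i (t, x) ⟨hQ.1, fun l hl => Ioo_subset_Icc_self (hx l hl)⟩
  have h1 := operator_nonneg_of_min r σ hr hΛ (hds t ht s hs i) hloc hlt.le
    fun j => hmin j (t, s) hQ
  have h2 : 0 ≤ deriv (fun τ => v τ s i) t :=
    deriv_nonneg_of_forall_ge htT (hdt t ht s hs i) fun x hx =>
      hmin i (x, s) ⟨⟨hQ.1.1.trans hx.1.le, hx.2.le⟩, hQ.2⟩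
  linarith [hsuper t ht s hs i]

theorem nonneg_of_supersolution {T : ℝ} {r : Fin k → ℝ} (hr : ∀ i, 0 ≤ r i)
    (σ : Fin k → Matrix (Fin d) (Fin d) ℝ) {Λ : Matrix (Fin k) (Fin k) ℝ} (hΛ : IsRateMatrix Λ)
    {w : ℝ → (Fin d → ℝ) → Fin k → ℝ}
    (hdt : ∀ t ∈ Ioo 0 T, ∀ s ∈ orthant d, ∀ i, DifferentiableAt ℝ (fun τ => w τ s i) t)
    (hds : ∀ t ∈ Ioo 0 T, ∀ s ∈ orthant d, ∀ i, ContDiffAt ℝ 2 (fun x => w t x i) s)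
    (hcont : ∀ i, ContinuousOn (fun p : ℝ × (Fin d → ℝ) => w p.1 p.2 i) (Ioc 0 T ×ˢ orthant d))
    (hsuper : ∀ t ∈ Ioo 0 T, ∀ s ∈ orthant d, ∀ i,
      deriv (fun τ => w τ s i) t + operator r σ Λ w t s i ≤ 0)
    (hT : ∀ s ∈ orthant d, ∀ i, 0 ≤ w T s i) {C : ℝ} (hC : 0 ≤ C)
    (hgrowth : ∀ t ∈ Ioo 0 T, ∀ s ∈ orthant d, ∀ i, -(C * (1 + ∑ l, s l)) ≤ w t s i) :
    ∀ t ∈ Ioc 0 T, ∀ s ∈ orthant d, ∀ i, 0 ≤ w t s i := by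
  obtain ⟨A, hA, hAL⟩ := exists_operator_lyapunov_lt hr σ hΛ
  have hcd : ∀ s ∈ orthant d, ContDiffAt ℝ 2 (lyapunov (d := d)) s := fun s hs =>
    contDiffOn_lyapunov.contDiffAt (isOpen_orthant.mem_nhds hs)
  have key : ∀ ε > 0, ∀ t ∈ Ioc 0 T, ∀ s ∈ orthant d, ∀ i,
      0 ≤ w t s i + ε * Real.exp (A * (T - t)) * lyapunov s := by
    intro ε hε
    obtain ⟨B, hB, hbox⟩ := exists_box_of_lyapunov_lt d hε hC
    have hexp : ∀ t, HasDerivAt (fun τ => ε * Real.exp (A * (T - τ)))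
        (-A * (ε * Real.exp (A * (T - t)))) t := fun t => by
      have h := ((((hasDerivAt_id t).const_sub T).const_mul A).exp).const_mul ε
      refine h.congr_deriv ?_
      simp only [id]
      ring
    refine nonneg_of_strict_supersolution hr σ hΛ (B := B)
      (v := fun t s i => w t s i + ε * Real.exp (A * (T - t)) * lyapunov s) ?_ ?_ ?_ ?_ ?_ hB ?_
    · exact fun t ht s hs i =>
        (hdt t ht s hs i).fun_add ((hexp t).mul_const (lyapunov s)).differentiableAt
    · exact fun t ht s hs i => (hds t ht s hs i).add (contDiffAt_const.mul (hcd s hs))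
    · refine fun i => (hcont i).add (ContinuousOn.mul (by fun_prop) ?_)
      exact contDiffOn_lyapunov.continuousOn.comp continuousOn_snd fun p hp => hp.2
    · intro t ht s hs i
      have h1 := ((hdt t ht s hs i).hasDerivAt.fun_add ((hexp t).mul_const (lyapunov s))).deriv
      rw [h1, operator_add r σ Λ (v := fun t x _ => ε * Real.exp (A * (T - t)) * lyapunov x)
        (hds t ht s hs i) (contDiffAt_const.mul (hcd s hs)),
        operator_const_mul r σ Λ (fun t => ε * Real.exp (A * (T - t))) (fun _ x _ => lyapunov x)]
      have h2 := mul_lt_mul_of_pos_left (hAL t s hs i)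
        (by positivity : 0 < ε * Real.exp (A * (T - t)))
      linarith [hsuper t ht s hs i]
    · intro s hs i
      have := one_le_lyapunov hs
      have := hT s hs i
      positivity
    · intro t ht s hs i hlt
      refine hbox s hs ?_
      have h1 : 1 ≤ Real.exp (A * (T - t)) :=
        Real.one_le_exp (mul_nonneg hA (sub_nonneg.2 ht.2.le))
      have h2 : ε * lyapunov s ≤ ε * Real.exp (A * (T - t)) * lyapunov s :=
        mul_le_mul_of_nonneg_right (le_mul_of_one_le_right hε.le h1)
          (zero_le_one.trans (one_le_lyapunov hs))
      linarith [hgrowth t ht s hs i]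
  intro t ht s hs i
  have hlim : Tendsto (fun ε => w t s i + ε * Real.exp (A * (T - t)) * lyapunov s) (𝓝[>] 0)
      (𝓝 (w t s i)) := by
    have : Continuous fun ε => w t s i + ε * Real.exp (A * (T - t)) * lyapunov s := by fun_prop
    simpa using (this.tendsto 0).mono_left nhdsWithin_le_nhds
  refine ge_of_tendsto hlim ?_
  filter_upwards [self_mem_nhdsWithin] with ε hε
  exact key ε hε t ht s hs i

/-- One-sided comparison of `c φ` with `b e^{-m(T-t)} + q · s`, where `m` is a lower bound of the
interest rates. -/
theorem IsClassicalSolution.nonneg_comparison {T : ℝ} {r : Fin k → ℝ} (hr : ∀ i, 0 ≤ r i)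
    {σ : Fin k → Matrix (Fin d) (Fin d) ℝ} {Λ : Matrix (Fin k) (Fin k) ℝ} (hΛ : IsRateMatrix Λ)
    {K : (Fin d → ℝ) → ℝ} {φ : ℝ → (Fin d → ℝ) → Fin k → ℝ}
    (hφ : IsClassicalSolution T r σ Λ K φ) (hφV : MemV T φ) {m : ℝ} (hm : ∀ i, m ≤ r i)
    (c : ℝ) {b : ℝ} (hb : 0 ≤ b) (q : Fin d → ℝ)
    (hK : ∀ s ∈ orthant d, 0 ≤ c * K s + (b + q ⬝ᵥ s)) :
    ∀ t ∈ Ioc 0 T, ∀ s ∈ orthant d, ∀ i,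
      0 ≤ c * φ t s i + (b * Real.exp (-m * (T - t)) + q ⬝ᵥ s) := by
  obtain ⟨C, hC⟩ := hφV.bounded
  have hlin : ContDiff ℝ 2 fun x : Fin d → ℝ => q ⬝ᵥ x := by
    unfold dotProduct
    fun_prop
  have hexp : ∀ t, HasDerivAt (fun τ => b * Real.exp (-m * (T - τ)))
      (m * (b * Real.exp (-m * (T - t)))) t := fun t => by
    have h := ((((hasDerivAt_id t).const_sub T).const_mul (-m)).exp).const_mul b
    refine h.congr_deriv ?_
    simp only [id]
    ring
  have hcd : ∀ t ∈ Ioo 0 T, ∀ s ∈ orthant d, ∀ i, ContDiffAt ℝ 2 (fun x => φ t x i) s :=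
    fun t ht s hs i => ((hφ.regular i).contDiff_s t ht).contDiffAt (isOpen_orthant.mem_nhds hs)
  refine nonneg_of_supersolution hr σ hΛ
    (w := fun t s i => c * φ t s i + (b * Real.exp (-m * (T - t)) + q ⬝ᵥ s))
    -- The two terms control `c * φ` and `q ⬝ᵥ s`; the exponential term is nonnegative and can be
    -- dropped.
    (C := |c| * |C| + ∑ l, |q l|) ?_ ?_ ?_ ?_ ?_ (by positivity) ?_
  · exact fun t ht s hs i => (((hφ.regular i).diff_t t ht s hs).const_mul c).fun_add
      ((hexp t).add_const _).differentiableAt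
  · exact fun t ht s hs i => (contDiffAt_const.mul (hcd t ht s hs i)).add
      (contDiffAt_const.add hlin.contDiffAt)
  · refine fun i => (continuousOn_const.mul (hφ.cont i)).add (ContinuousOn.add (by fun_prop) ?_)
    exact (hlin.continuous.comp continuous_snd).continuousOn
  · intro t ht s hs i
    have h1 := ((((hφ.regular i).diff_t t ht s hs).hasDerivAt.const_mul c).fun_add
      ((hexp t).add_const (q ⬝ᵥ s))).deriv
    rw [h1, operator_add r σ Λ (u := fun t x i => c * φ t x i)
      (v := fun t x _ => b * Real.exp (-m * (T - t)) + q ⬝ᵥ x)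
      (contDiffAt_const.mul (hcd t ht s hs i)) (contDiffAt_const.add hlin.contDiffAt),
      operator_const_mul r σ Λ (fun _ => c) φ]
    have h2 := operator_const_add_sum r σ hΛ (fun t => b * Real.exp (-m * (T - t)))
      (h := fun l y => q l * y) t hs (fun _ _ _ => by fun_prop) i
    have h3 : ∀ l, deriv (fun y => q l * y) = fun _ => q l := fun l => by
      funext y
      simp
    simp only [h3, deriv_const, mul_zero, Finset.sum_const_zero] at h2
    have h4 : ∑ l, s l * q l = ∑ l, q l * s l := Finset.sum_congr rfl fun l _ => mul_comm _ _
    rw [h4] at h2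
    change operator r σ Λ (fun t x _ => b * Real.exp (-m * (T - t)) + q ⬝ᵥ x) t s i = _ at h2
    rw [h2]
    have h5 := congrArg (c * ·) (hφ.pde t ht s hs i)
    have h6 := mul_le_mul_of_nonneg_right (hm i)
      (mul_nonneg hb (Real.exp_pos (-m * (T - t))).le)
    simp only [mul_zero] at h5
    linarith
  · intro s hs i
    simpa [hφ.terminal s hs i] using hK s hs
  · intro t ht s hs i
    have hS : 0 ≤ ∑ l, s l := Finset.sum_nonneg fun l _ => (hs l).le
    have h1 : |φ t s i| ≤ |C| * (1 + ∑ l, s l) := by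
      have h := (hC t ht s hs i).trans (le_abs_self C)
      rw [Finset.sum_congr rfl fun l _ => abs_of_pos (hs l), abs_div,
        abs_of_pos (by linarith : 0 < 1 + ∑ l, s l), div_le_iff₀ (by linarith)] at h
      exact h
    have h2 : |c * φ t s i| ≤ |c| * |C| * (1 + ∑ l, s l) := by
      rw [abs_mul, mul_assoc]
      exact mul_le_mul_of_nonneg_left h1 (abs_nonneg c)
    have h3 : |q ⬝ᵥ s| ≤ (∑ l, |q l|) * (1 + ∑ l, s l) := by
      refine (Finset.abs_sum_le_sum_abs _ _).trans ?_
      rw [Finset.sum_mul]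
      refine Finset.sum_le_sum fun l _ => ?_
      rw [abs_mul, abs_of_pos (hs l)]
      have := Finset.single_le_sum (fun j _ => (hs j).le) (Finset.mem_univ l)
      exact mul_le_mul_of_nonneg_left (by linarith) (abs_nonneg _)
    have h4 := mul_nonneg hb (Real.exp_pos (-m * (T - t))).le
    linarith [neg_le_of_abs_le h2, neg_le_of_abs_le h3]

end RegimeSwitching

theorem theorem4p1 {d k : ℕ} (T : ℝ) (hT : 0 < T)
    (r : Fin k → ℝ) (hr : ∀ i, 0 ≤ r i)
    (σ : Fin k → Matrix (Fin d) (Fin d) ℝ) (hσ : ∀ i, IsUnit (σ i))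
    (Λ : Matrix (Fin k) (Fin k) ℝ) (hΛ : RegimeSwitching.IsRateMatrix Λ)
    (K : (Fin d → ℝ) → ℝ)
    (hK_nonneg : ∀ s ∈ RegimeSwitching.orthant d, 0 ≤ K s)
    (hK_lip : ∃ L : ℝ≥0, LipschitzOnWith L K (RegimeSwitching.orthant d))
    (k₁ k₃ : ℝ) (hk₁ : 0 ≤ k₁) (hk₃ : 0 ≤ k₃) (k₂ k₄ : Fin d → ℝ)
    (hK_growth : ∀ s ∈ RegimeSwitching.orthant d,
      -k₃ + k₄ ⬝ᵥ s ≤ K s ∧ K s ≤ k₁ + k₂ ⬝ᵥ s)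
    (φ : ℝ → (Fin d → ℝ) → Fin k → ℝ)
    (hφ : RegimeSwitching.IsClassicalSolution T r σ Λ K φ)
    (hφV : RegimeSwitching.MemV T φ) :
    ∀ t ∈ Set.Ioc 0 T, ∀ s ∈ RegimeSwitching.orthant d, ∀ i,
      -k₃ * Real.exp (-(⨅ j, r j) * (T - t)) + k₄ ⬝ᵥ s ≤ φ t s i ∧
      φ t s i ≤ k₁ * Real.exp (-(⨅ j, r j) * (T - t)) + k₂ ⬝ᵥ s := by
  have hm : ∀ i, (⨅ j, r j) ≤ r i := fun i => ciInf_le (Set.finite_range r).bddBelow i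
  intro t ht s hs i
  -- The signs `c = 1` and `c = -1` turn the one-sided comparison into the lower and the upper
  -- bound.
  have hlow := hφ.nonneg_comparison hr hΛ hφV hm 1 hk₃ (-k₄)
    (fun s hs => by rw [neg_dotProduct]; linarith [(hK_growth s hs).1]) t ht s hs i
  have hup := hφ.nonneg_comparison hr hΛ hφV hm (-1) hk₁ k₂
    (fun s hs => by linarith [(hK_growth s hs).2]) t ht s hs i
  rw [neg_dotProduct] at hlow
  constructor <;> linarith
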